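/- Let $G$ be a topological group. A continuous discrete $G$-set is a discrete space $X$ with a continuous action of $G$. A subset $M\subset X$ is commensurated if $M\bigtriangleup gM$ is finite for every $g\in G$, and transfixed if there is a $G$-invariant subset $N\subset X$ such that $M\bigtriangleup N$ is finite. The group $G$ has Property FW if, for every continuous discrete $G$-set $X$, every commensurated subset of $X$ is transfixed; it has Property FW' if this holds for every transitive continuous discrete $G$-set $X$. Let $\pi:H\to Q$ be a continuous homomorphism with dense image between locally compact groups. For a continuous orthogonal representation $u$ of $H$ on a real Hilbert space $\mathcal{H}$, let $\mathcal{H}^Q$ be the closed subspace of those $v\in\mathcal{H}$ such that $$\inf_{V}\ \sup_{g\in V}\|u(g)v-v\|=0,$$ where $V$ ranges over the subsets of $H$ that contain $\pi^{-1}(U)$ for some neighbourhood $U$ of $1$ in $Q$. The action of $H$ on $\mathcal{H}^Q$ factors uniquely through a continuous orthogonal representation $u^Q$ of $Q$ on $\mathcal{H}^Q$. An orthogonal representation $u$ of a topological group $G$ almost has invariant vectors if for every compact $K\subset G$ and every $\varepsilon>0$ there is a unit vector $v$ with $\|u(g)v-v\|<\varepsilon$ for all $g\in K$. The homomorphism $\pi$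 is called a Kazhdan homomorphism if for every continuous orthogonal representation $u$ of $H$ that almost has invariant vectors, $u^Q$ almost has invariant vectors. **Theorem.** Let $\pi:H\to Q$ be a continuous homomorphism with dense image between locally compact groups, and suppose that $\pi$ is a Kazhdan homomorphism. Then $H$ has Property FW if and only if $Q$ has Property FW, and $H$ has Property FW' if and only if $Q$ has Property FW'. -/

import Mathlib

open Filter Topology
open scoped Pointwise symmDiff

universe u

/-! ### Commensurating actions, Properties FW and FW' -/

section FW

/-- The subset `M` of the `G`-set `X` is commensurated: `M ∆ gM` is finite for every `g`. -/
def IsCommensurated (G : Type*) {X : Type*} [Group G] [MulAction G X] (M : Set X) : Prop :=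
  ∀ g : G, (M ∆ (g • M)).Finite

/-- The subset `M` of the `G`-set `X` is transfixed: there is a `G`-invariant subset `N`
such that `M ∆ N` is finite. -/
def IsTransfixed (G : Type*) {X : Type*} [Group G] [MulAction G X] (M : Set X) : Prop :=
  ∃ N : Set X, (∀ g : G, g • N = N) ∧ (M ∆ N).Finite

/-- Property FW: in every continuous discrete `G`-set, every commensurated subset is
transfixed. -/
def HasPropertyFW (G : Type u) [Group G] [TopologicalSpace G] : Prop :=
  ∀ (X : Type u) [TopologicalSpace X] [DiscreteTopology X] [MulAction G X] [ContinuousSMul G X]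
    (M : Set X), IsCommensurated G M → IsTransfixed G M

/-- Property FW': the same as Property FW, for transitive continuous discrete `G`-sets. -/
def HasPropertyFW' (G : Type u) [Group G] [TopologicalSpace G] : Prop :=
  ∀ (X : Type u) [TopologicalSpace X] [DiscreteTopology X] [MulAction G X] [ContinuousSMul G X]
    [MulAction.IsPretransitive G X] (M : Set X), IsCommensurated G M → IsTransfixed G M

end FW

/-! ### Orthogonal representations -/

section Rep

variable {G E : Type*} [Group G] [TopologicalSpace G] [NormedAddCommGroup E]
  [InnerProductSpace ℝ E]

/-- Continuity of an orthogonal representation: all orbit maps are continuous. -/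
def IsContinuousRep (u : G →* (E ≃ₗᵢ[ℝ] E)) : Prop :=
  ∀ v : E, Continuous fun g => u g v

/-- `1 ≺ u`: the orthogonal representation `u` almost has invariant vectors. -/
def AlmostHasInvariantVectors (u : G →* (E ≃ₗᵢ[ℝ] E)) : Prop :=
  ∀ K : Set G, IsCompact K → ∀ ε : ℝ, 0 < ε → ∃ v : E, ‖v‖ = 1 ∧ ∀ g ∈ K, ‖u g v - v‖ < ε

end Rep

/-! ### `Q`-points -/

section QPoints

theorem rep_mul {H E : Type*} [Group H] [NormedAddCommGroup E] [InnerProductSpace ℝ E]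
    (u : H →* (E ≃ₗᵢ[ℝ] E)) (g h : H) (v : E) : u (g * h) v = u g (u h v) := by
  rw [map_mul]
  rfl

variable {H Q E : Type*} [Group H] [Group Q] [TopologicalSpace Q]
  [NormedAddCommGroup E] [InnerProductSpace ℝ E]

/-- `v` is a `Q`-point: `inf_V sup_{g ∈ V} d(v, gv) = 0`, where `V` ranges over the subsets
of `H` containing `π⁻¹(U)` for some neighbourhood `U` of `1` in `Q`. -/
def IsQPoint (π : H →* Q) (u : H →* (E ≃ₗᵢ[ℝ] E)) (v : E) : Prop :=
  ⨅ V ∈ comap π (𝓝 (1 : Q)), ⨆ g ∈ V, edist v (u g v) = 0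

theorem isQPoint_iff_tendsto (π : H →* Q) (u : H →* (E ≃ₗᵢ[ℝ] E)) (v : E) :
    IsQPoint π u v ↔ Tendsto (fun h => u h v) (comap π (𝓝 (1 : Q))) (𝓝 v) := by
  unfold IsQPoint
  rw [EMetric.tendsto_nhds]
  constructor
  · intro h ε hε
    rw [← h] at hε
    simp only [iInf_lt_iff] at hε
    obtain ⟨V, hV, hlt⟩ := hε
    filter_upwards [hV] with g hg
    rw [edist_comm]
    exact lt_of_le_of_lt (le_iSup₂ (f := fun g (_ : g ∈ V) => edist v (u g v)) g hg) hlt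
  · intro h
    refine le_antisymm (le_of_forall_gt fun ε hε => ?_) bot_le
    obtain ⟨δ, hδ, hδε⟩ := exists_between hε
    refine lt_of_le_of_lt (iInf₂_le {x | edist (u x v) v < δ} (h δ hδ)) (lt_of_le_of_lt (iSup₂_le fun g hg => ?_) hδε)
    rw [edist_comm]
    exact le_of_lt hg

/-- The subspace of `Q`-points of an orthogonal representation. -/
def qPoints (π : H →* Q) (u : H →* (E ≃ₗᵢ[ℝ] E)) : Submodule ℝ E where
  carrier := {v | IsQPoint π u v}
  add_mem' := by
    intro v w hv hw
    simp only [Set.mem_ofPred_eq, isQPoint_iff_tendsto, map_add] at *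
    exact hv.add hw
  zero_mem' := by
    simp only [Set.mem_ofPred_eq, isQPoint_iff_tendsto, map_zero]
    exact tendsto_const_nhds
  smul_mem' := by
    intro c v hv
    simp only [Set.mem_ofPred_eq, isQPoint_iff_tendsto, map_smul] at *
    exact hv.const_smul c

theorem mem_qPoints (π : H →* Q) (u : H →* (E ≃ₗᵢ[ℝ] E)) (v : E) :
    v ∈ qPoints π u ↔ Tendsto (fun h => u h v) (comap π (𝓝 (1 : Q))) (𝓝 v) :=
  isQPoint_iff_tendsto π u v

theorem qPoints_isClosed (π : H →* Q) (u : H →* (E ≃ₗᵢ[ℝ] E)) :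
    IsClosed (qPoints π u : Set E) := by
  refine isClosed_of_closure_subset fun v hv => ?_
  rw [SetLike.mem_coe, mem_qPoints, Metric.tendsto_nhds]
  intro ε hε
  obtain ⟨w, hw, hvw⟩ := Metric.mem_closure_iff.1 hv (ε / 3) (by positivity)
  rw [SetLike.mem_coe, mem_qPoints, Metric.tendsto_nhds] at hw
  filter_upwards [hw (ε / 3) (by positivity)] with h hh
  have h1 : dist (u h v) (u h w) = dist v w := (u h).dist_map v w
  have h2 := dist_triangle4 (u h v) (u h w) w v
  rw [dist_comm w v] at h2
  linarith

/-- The action of `q : Q` on a `Q`-point `v`: the limit of `u(h) v` as `π(h)` tends to `q`. -/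
noncomputable def qAct (π : H →* Q) (u : H →* (E ≃ₗᵢ[ℝ] E)) (q : Q) (v : E) : E :=
  limUnder (comap π (𝓝 q)) fun h => u h v

theorem neBot_comap {π : H →* Q} (hd : DenseRange π) (q : Q) : NeBot (comap π (𝓝 q)) :=
  comap_neBot fun _ ht => by
    obtain ⟨_, h1, h, rfl⟩ := mem_closure_iff_nhds.1 (hd q) _ ht
    exact ⟨h, h1⟩

theorem qAct_eq {π : H →* Q} (hd : DenseRange π) (u : H →* (E ≃ₗᵢ[ℝ] E)) {q : Q} {v w : E}
    (h : Tendsto (fun h => u h v) (comap π (𝓝 q)) (𝓝 w)) : qAct π u q v = w := by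
  have := neBot_comap hd q
  exact h.limUnder_eq

theorem qAct_one {π : H →* Q} (hd : DenseRange π) (u : H →* (E ≃ₗᵢ[ℝ] E)) {v : E}
    (hv : v ∈ qPoints π u) : qAct π u 1 v = v :=
  qAct_eq hd u ((mem_qPoints π u v).1 hv)

variable [IsTopologicalGroup Q]

theorem qPoints_invariant (π : H →* Q) (u : H →* (E ≃ₗᵢ[ℝ] E)) {v : E}
    (hv : v ∈ qPoints π u) (h : H) : u h v ∈ qPoints π u := by
  rw [mem_qPoints] at *
  have h1 : Tendsto (fun k => h⁻¹ * k * h) (comap π (𝓝 (1 : Q))) (comap π (𝓝 (1 : Q))) := by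
    rw [tendsto_comap_iff]
    have : Tendsto (fun q : Q => (π h)⁻¹ * q * π h) (𝓝 1) (𝓝 1) := by
      have hc : Continuous fun q : Q => (π h)⁻¹ * q * π h := by fun_prop
      simpa using hc.tendsto 1
    simpa [Function.comp_def] using this.comp tendsto_comap
  have h2 := ((u h).continuous.tendsto v).comp (hv.comp h1)
  refine h2.congr fun k => ?_
  simp only [Function.comp_apply, ← rep_mul, mul_assoc, mul_inv_cancel_left]

variable [CompleteSpace E]

theorem tendsto_qAct {π : H →* Q} (hd : DenseRange π) (u : H →* (E ≃ₗᵢ[ℝ] E)) (q : Q) {v : E}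
    (hv : v ∈ qPoints π u) : Tendsto (fun h => u h v) (comap π (𝓝 q)) (𝓝 (qAct π u q v)) := by
  have := neBot_comap hd q
  refine tendsto_nhds_limUnder (cauchy_map_iff_exists_tendsto.1 (cauchy_map_iff.2 ⟨this, ?_⟩))
  rw [Metric.uniformity_basis_dist.tendsto_right_iff]
  intro ε hε
  rw [mem_qPoints, Metric.tendsto_nhds] at hv
  have h1 : Tendsto (fun p : H × H => p.2⁻¹ * p.1) (comap π (𝓝 q) ×ˢ comap π (𝓝 q))
      (comap π (𝓝 (1 : Q))) := by
    rw [tendsto_comap_iff]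
    have h2 : Tendsto (fun p : Q × Q => p.2⁻¹ * p.1) (𝓝 q ×ˢ 𝓝 q) (𝓝 1) := by
      have hc : Continuous fun p : Q × Q => p.2⁻¹ * p.1 := by fun_prop
      simpa [nhds_prod_eq] using hc.tendsto (q, q)
    have h3 := h2.comp ((tendsto_comap (f := π) (x := 𝓝 q)).prodMap
      (tendsto_comap (f := π) (x := 𝓝 q)))
    simpa [Function.comp_def] using h3
  filter_upwards [h1.eventually (hv ε hε)] with p hp
  have h4 := (u p.2).dist_map (u (p.2⁻¹ * p.1) v) v
  simp only [← rep_mul, mul_inv_cancel_left] at h4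
  simpa only [Set.mem_ofPred_eq, h4] using hp

theorem qAct_mem {π : H →* Q} (hd : DenseRange π) (u : H →* (E ≃ₗᵢ[ℝ] E)) (q : Q) {v : E}
    (hv : v ∈ qPoints π u) : qAct π u q v ∈ qPoints π u := by
  have := neBot_comap hd q
  exact (qPoints_isClosed π u).mem_of_tendsto (tendsto_qAct hd u q hv)
    (Eventually.of_forall fun h => qPoints_invariant π u hv h)

theorem qAct_mul {π : H →* Q} (hd : DenseRange π) (u : H →* (E ≃ₗᵢ[ℝ] E)) (q r : Q) {v : E}
    (hv : v ∈ qPoints π u) : qAct π u (q * r) v = qAct π u q (qAct π u r v) := by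
  have := neBot_comap hd q
  have := neBot_comap hd r
  have h1 : Tendsto (fun p : H × H => p.1 * p.2) (comap π (𝓝 q) ×ˢ comap π (𝓝 r))
      (comap π (𝓝 (q * r))) := by
    rw [tendsto_comap_iff]
    have h2 : Tendsto (fun p : Q × Q => p.1 * p.2) (𝓝 q ×ˢ 𝓝 r) (𝓝 (q * r)) := by
      simpa [nhds_prod_eq] using (continuous_mul (M := Q)).tendsto (q, r)
    have h3 := h2.comp ((tendsto_comap (f := π) (x := 𝓝 q)).prodMap
      (tendsto_comap (f := π) (x := 𝓝 r)))
    simpa [Function.comp_def] using h3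
  have h4 := (tendsto_qAct hd u (q * r) hv).comp h1
  have h5 := (tendsto_qAct hd u q (qAct_mem hd u r hv)).comp
    (tendsto_fst (f := comap π (𝓝 q)) (g := comap π (𝓝 r)))
  have h6 := (tendsto_iff_dist_tendsto_zero.1 (tendsto_qAct hd u r hv)).comp
    (tendsto_snd (f := comap π (𝓝 q)) (g := comap π (𝓝 r)))
  refine tendsto_nhds_unique h4 (h5.congr_dist (h6.congr fun p => ?_))
  have h7 := (u p.1).dist_map (u p.2 v) (qAct π u r v)
  simp only [Function.comp_apply, rep_mul]
  rw [dist_comm (u p.1 (qAct π u r v)), h7]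

/-- The orthogonal representation `u^Q` of `Q` on the space of `Q`-points: the one through
which the action of `H` on the `Q`-points factors (see `qRep_map`, `qRep_continuous`). -/
noncomputable def qRep (π : H →* Q) (hd : DenseRange π) (u : H →* (E ≃ₗᵢ[ℝ] E)) :
    Q →* (qPoints π u ≃ₗᵢ[ℝ] qPoints π u) where
  toFun q :=
    { toFun := fun v => ⟨qAct π u q v, qAct_mem hd u q v.2⟩
      invFun := fun v => ⟨qAct π u q⁻¹ v, qAct_mem hd u q⁻¹ v.2⟩
      left_inv := fun v => Subtype.ext <| by
        simp only [← qAct_mul hd u _ _ v.2, inv_mul_cancel, qAct_one hd u v.2]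
      right_inv := fun v => Subtype.ext <| by
        simp only [← qAct_mul hd u _ _ v.2, mul_inv_cancel, qAct_one hd u v.2]
      map_add' := fun v w => Subtype.ext <| qAct_eq hd u <| by
        simpa using (tendsto_qAct hd u q v.2).add (tendsto_qAct hd u q w.2)
      map_smul' := fun c v => Subtype.ext <| qAct_eq hd u <| by
        simpa using (tendsto_qAct hd u q v.2).const_smul c
      norm_map' := fun v => by
        have := neBot_comap hd q
        have h := (tendsto_qAct hd u q v.2).norm
        simp only [LinearIsometryEquiv.norm_map] at h
        exact (tendsto_nhds_unique h tendsto_const_nhds) }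
  map_one' := by
    ext v
    exact qAct_one hd u v.2
  map_mul' q r := by
    ext v
    exact qAct_mul hd u q r v.2

theorem qRep_map (π : H →* Q) (hd : DenseRange π) (u : H →* (E ≃ₗᵢ[ℝ] E)) (h : H)
    (v : qPoints π u) : (qRep π hd u (π h) v : E) = u h v := by
  have h1 : (pure h : Filter H) ≤ comap π (𝓝 (π h)) :=
    map_le_iff_le_comap.1 (by simpa using pure_le_nhds (π h))
  exact tendsto_nhds_unique ((tendsto_qAct hd u (π h) v.2).mono_left h1)
    (tendsto_pure_nhds (fun k => u k (v : E)) h)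

theorem qRep_continuous (π : H →* Q) (hd : DenseRange π) (u : H →* (E ≃ₗᵢ[ℝ] E)) :
    IsContinuousRep (qRep π hd u) := by
  intro v
  rw [continuous_induced_rng, continuous_iff_continuousAt]
  intro q
  refine (Metric.nhds_basis_closedBall.tendsto_right_iff).2 fun ε hε => ?_
  have h1 := Metric.nhds_basis_closedBall.tendsto_right_iff.1 (tendsto_qAct hd u q v.2) ε hε
  rw [eventually_comap] at h1
  filter_upwards [eventually_eventually_nhds.2 h1] with r hr
  have := neBot_comap hd r
  refine Metric.isClosed_closedBall.mem_of_tendsto (tendsto_qAct hd u r v.2) ?_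
  filter_upwards [tendsto_comap.eventually hr] with h hh
  exact hh h rfl

end QPoints

/-! ### Kazhdan homomorphisms -/

/-- A homomorphism `π : H → Q` with dense image is a Kazhdan homomorphism if, for every
continuous orthogonal representation `u` of `H` on a real Hilbert space, `1 ≺ u` implies
`1 ≺ u^Q`. -/
def IsKazhdanHom {H Q : Type u} [Group H] [TopologicalSpace H] [Group Q]
    [TopologicalSpace Q] [IsTopologicalGroup Q] (π : H →* Q) (hd : DenseRange π) : Prop :=
  ∀ (E : Type u) [NormedAddCommGroup E] [InnerProductSpace ℝ E] [CompleteSpace E]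
    (u : H →* (E ≃ₗᵢ[ℝ] E)), IsContinuousRep u → AlmostHasInvariantVectors u →
      AlmostHasInvariantVectors (qRep π hd u)

/-!
Let `π : H → Q` be a continuous homomorphism with dense image. A continuous discrete `Q`-set is a
continuous discrete `H`-set through `π`, with the same orbits because stabilizers are open. This gives the
passage of Properties FW and FW' from `H` to `Q`, without the Kazhdan assumption.

For the converse, let `M` be a commensurated subset of a continuous discrete `H`-set `X`. The proof
finds a set almost equal to `M` that is invariant under `π⁻¹(V)` for a neighbourhood `V` of `1`
in `Q`, and then a `Q`-set that controls it.

* *Asymptotic centre* (`exists_eventually_smul_eq`). If `|M ∆ hM|` is bounded for `h` near `1`, for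
  a suitable notion of nearness, then `M` is almost equal to a set fixed by all `h` near `1`. The
  squared `ℓ²`-distance on the functions almost equal to the indicator function of `M` satisfies
  the parallelogram identity, so an approximate centre of the translates `hM`, with `h` near `1`,
  is almost fixed, uniformly on `X`; the number of its values in `[1/3, 2/3)` is bounded a priori,
  so a superlevel set at a gap between these values is fixed.
* *Open stabilizers* (`IsCommensurated.eventually_smul_eq`). A locally compact group is a Baire
  space, so `|M ∆ hM|` is bounded near `1` in `H`; the previous point, applied to the
  neighbourhoods of `1` in `H`, shows that `M` has an open stabilizer.
* *The Kazhdan property* (`IsKazhdanHom.exists_eventually_ncard_le`). For `0 ≤ c < 1`, the function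
  `h ↦ c ^ |M ∆ hM|` is a coefficient of a continuous orthogonal representation, because
  `c ^ |A ∆ B|` is a Gram matrix on the finite subsets of `X` (`inner_tensorVec`). Take the sum of
  these representations over a sequence of values of `c` that tends to `1`. The orthogonal
  complement of its `Q`-points has no nonzero `Q`-point, so it does not almost have invariant
  vectors. Hence for `c` close to `1` the unit vector with coefficient `c ^ |M ∆ hM|` is close to a
  `Q`-point, and `|M ∆ hM|` is bounded on `π⁻¹(V)` for some `V`. The asymptotic centre for the
  filter `comap π (𝓝 1)` now replaces `M` by a set `M'` that is invariant under some `π⁻¹(V)`.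
* *The `Q`-set* (`isTransfixed_of_qSet`). For `x` in `X`, either the orbit `π⁻¹(V) x` is finite for
  some `V`, or `M'` contains all of `Hx` or none of it, as `M' ∆ gM'` is finite and is invariant
  under some `π⁻¹(V)`. On the set `X₁` of the points of the first kind, the closure of the image of
  each stabilizer is open in `Q`, so the separated balanced product `Q ×_H X₁` is a continuous
  discrete `Q`-set. The canonical map from `X₁` to it is onto with finite fibres, and `M' ∩ X₁` is a
  union of fibres. Its image is commensurated by `Q`, and if this image is transfixed, then so
  is `M'`. If `H` is transitive on `X`, then `Q` is transitive on `Q ×_H X₁`.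
-/

/-! ### Almost equal sets and functions -/

section AlmostEqual

variable {H X : Type*} [Group H] [MulAction H X]

theorem finite_symmDiff_trans {A B C : Set X} (h₁ : (A ∆ B).Finite) (h₂ : (B ∆ C).Finite) :
    (A ∆ C).Finite :=
  (h₁.union h₂).subset (symmDiff_triangle A B C)

theorem Set.Finite.smul_symmDiff {A B : Set X} (h : (A ∆ B).Finite) (g : H) :
    ((g • A) ∆ (g • B)).Finite := by
  rw [← Set.smul_set_symmDiff]
  exact h.smul_set

theorem IsCommensurated.of_finite_symmDiff {M M' : Set X} (hM : IsCommensurated H M)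
    (h : (M ∆ M').Finite) : IsCommensurated H M' := fun g =>
  finite_symmDiff_trans (by rwa [symmDiff_comm])
    (finite_symmDiff_trans (hM g) (h.smul_symmDiff g))

theorem IsTransfixed.of_finite_symmDiff {M M' : Set X} (hM' : IsTransfixed H M')
    (h : (M ∆ M').Finite) : IsTransfixed H M := by
  obtain ⟨N, hN, hfin⟩ := hM'
  exact ⟨N, hN, finite_symmDiff_trans h hfin⟩

/-- The translate of a function on an `H`-set by `h : H`. -/
def translateBy (h : H) (w : X → ℝ) : X → ℝ := fun x => w (h⁻¹ • x)

theorem translateBy_indicator (h : H) (M : Set X) :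
    translateBy h (M.indicator 1) = (h • M).indicator 1 := by
  classical
  ext x
  simp only [translateBy, Set.indicator_apply, Set.mem_smul_set_iff_inv_smul_mem]
  rfl

theorem translateBy_mul (g h : H) (w : X → ℝ) :
    translateBy g (translateBy h w) = translateBy (g * h) w := by
  ext x
  simp [translateBy, mul_smul]

theorem Filter.EventuallyEq.translateBy {v w : X → ℝ} (hvw : v =ᶠ[cofinite] w) (h : H) :
    translateBy h v =ᶠ[cofinite] translateBy h w :=
  (MulAction.injective (h⁻¹ : H)).tendsto_cofinite.eventually hvw

theorem indicator_eventuallyEq_cofinite {A B : Set X} (h : (A ∆ B).Finite) :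
    A.indicator (1 : X → ℝ) =ᶠ[cofinite] B.indicator 1 := by
  classical
  refine mem_cofinite.2 (h.subset fun x hx => ?_)
  by_contra hx'
  refine hx ?_
  rw [Set.mem_symmDiff] at hx'
  simp only [Set.mem_ofPred_eq, Set.indicator_apply]
  by_cases h1 : x ∈ A <;> by_cases h2 : x ∈ B <;> simp_all

/-- The squared `ℓ²`-distance between two real functions that agree outside a finite set. It is
the junk value `0` if they do not. -/
noncomputable def sqDist (v w : X → ℝ) : ℝ := ∑ᶠ x, (v x - w x) ^ 2

theorem sqDist_nonneg (v w : X → ℝ) : 0 ≤ sqDist v w := finsum_nonneg fun _ => sq_nonneg _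

theorem finite_support_sq_sub {v w : X → ℝ} (h : v =ᶠ[cofinite] w) :
    (Function.support fun x => (v x - w x) ^ 2).Finite := by
  refine (mem_cofinite.1 h).subset fun x hx hx' => hx ?_
  simp only [Set.mem_ofPred_eq] at hx'
  simp [hx']

theorem sqDist_translateBy (h : H) (v w : X → ℝ) :
    sqDist (translateBy h v) (translateBy h w) = sqDist v w :=
  finsum_comp_equiv (MulAction.toPerm (h⁻¹ : H)) (f := fun x => (v x - w x) ^ 2)

theorem sum_le_sqDist {v w : X → ℝ} (h : v =ᶠ[cofinite] w) (s : Finset X) :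
    ∑ x ∈ s, (v x - w x) ^ 2 ≤ sqDist v w := by
  classical
  rw [sqDist, finsum_eq_sum_of_support_subset (s := (finite_support_sq_sub h).toFinset ∪ s) _
    (by intro x hx; simp only [Finset.coe_union, Set.Finite.coe_toFinset]; exact Or.inl hx)]
  exact Finset.sum_le_sum_of_subset_of_nonneg Finset.subset_union_right
    fun _ _ _ => sq_nonneg _

theorem sq_sub_le_sqDist {v w : X → ℝ} (h : v =ᶠ[cofinite] w) (x : X) :
    (v x - w x) ^ 2 ≤ sqDist v w := by
  simpa using sum_le_sqDist h {x}

/-- The parallelogram identity (Apollonius). -/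
theorem sqDist_midpoint {v w w' : X → ℝ} (h : v =ᶠ[cofinite] w) (h' : v =ᶠ[cofinite] w') :
    sqDist v (fun x => (w x + w' x) / 2) =
      sqDist v w / 2 + sqDist v w' / 2 - sqDist w w' / 4 := by
  have h1 := finite_support_sq_sub h
  have h2 := finite_support_sq_sub h'
  have h3 := finite_support_sq_sub (h.symm.trans h')
  classical
  have key : ∀ a b : X → ℝ, (Function.support fun x => (a x - b x) ^ 2) ⊆
      (h1.toFinset ∪ h2.toFinset ∪ h3.toFinset : Finset X) →
      sqDist a b = ∑ x ∈ h1.toFinset ∪ h2.toFinset ∪ h3.toFinset, (a x - b x) ^ 2 :=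
    fun a b hab => finsum_eq_sum_of_support_subset _ hab
  rw [key v w, key v w', key w w', key v, Finset.sum_div, Finset.sum_div, Finset.sum_div,
    ← Finset.sum_add_distrib, ← Finset.sum_sub_distrib]
  · exact Finset.sum_congr rfl fun x _ => by ring
  · intro x hx
    by_contra hx'
    simp only [Finset.coe_union, Set.Finite.coe_toFinset, Set.mem_union, not_or,
      Function.mem_support, not_not, sq_eq_zero_iff, sub_eq_zero] at hx'
    apply hx
    simp only [← hx'.1.1, ← hx'.1.2]
    ring
  all_goals
    intro x hx
    simp only [Finset.coe_union, Set.Finite.coe_toFinset, Set.mem_union]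
    tauto

theorem sqDist_indicator {A B : Set X} (h : (A ∆ B).Finite) :
    sqDist (A.indicator 1) (B.indicator 1) = (A ∆ B).ncard := by
  classical
  rw [sqDist, finsum_eq_sum_of_support_subset (s := h.toFinset),
    Set.ncard_eq_toFinset_card _ h, Finset.card_eq_sum_ones, Nat.cast_sum]
  · refine Finset.sum_congr rfl fun x hx => ?_
    simp only [Set.Finite.mem_toFinset, Set.mem_symmDiff] at hx
    rcases hx with ⟨h1, h2⟩ | ⟨h1, h2⟩ <;> simp [h1, h2]
  · intro x hx
    by_contra hx'
    simp only [Set.Finite.coe_toFinset, Set.mem_symmDiff] at hx'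
    apply hx
    by_cases h1 : x ∈ A <;> by_cases h2 : x ∈ B <;> simp_all

end AlmostEqual

/-! ### The asymptotic centre of a bounded family of translates -/

section Centre

variable {H X : Type*} [Group H] [MulAction H X]

/-- If `w` is at squared distance less than `(n + 1) / 9` from the indicator function of `M`, then
one of the `n + 1` equal pieces of `[1/3, 2/3)` contains no value of `w`: each value in this
interval contributes at least `1 / 9` to the squared distance. -/
theorem exists_gap {M : Set X} {w : X → ℝ} (hw : M.indicator 1 =ᶠ[cofinite] w) {n : ℕ}
    (hn : 9 * sqDist (M.indicator 1) w < n + 1) :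
    ∃ a : ℝ, 1 / 3 ≤ a ∧ a + 1 / (3 * (n + 1)) ≤ 2 / 3 ∧
      ∀ x, w x < a ∨ a + 1 / (3 * (n + 1)) ≤ w x := by
  classical
  by_contra! hcon
  have hl : (0 : ℝ) < 1 / (3 * (n + 1)) := by positivity
  have hl' : ((n : ℝ) + 1) * (1 / (3 * (n + 1))) = 1 / 3 := by field_simp
  set l : ℝ := 1 / (3 * (n + 1))
  have hj : ∀ j : Fin (n + 1), ((j : ℕ) : ℝ) + 1 ≤ n + 1 := fun j => by
    have := j.2
    exact_mod_cast this
  have hx : ∀ j : Fin (n + 1), ∃ x, 1 / 3 + (j : ℕ) * l ≤ w x ∧ w x < 1 / 3 + (j : ℕ) * l + l := by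
    intro j
    refine hcon _ ?_ ?_
    · have : 0 ≤ ((j : ℕ) : ℝ) * l := by positivity
      linarith
    · have := mul_le_mul_of_nonneg_right (hj j) hl.le
      linarith
  choose x hx using hx
  have hlt : ∀ i j : Fin (n + 1), i < j → w (x i) < w (x j) := by
    intro i j hij
    have h1 : ((i : ℕ) : ℝ) + 1 ≤ (j : ℕ) := by exact_mod_cast hij
    have := mul_le_mul_of_nonneg_right h1 hl.le
    linarith [(hx i).2, (hx j).1]
  have hinj : Function.Injective x := by
    intro i j hij
    rcases lt_trichotomy i j with h | h | h
    · exact absurd (congrArg w hij) (hlt i j h).ne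
    · exact h
    · exact absurd (congrArg w hij) (hlt j i h).ne'
  have hsum := sum_le_sqDist hw (Finset.univ.map ⟨x, hinj⟩)
  rw [Finset.sum_map] at hsum
  have hge : ∀ j : Fin (n + 1), (1 / 9 : ℝ) ≤ (M.indicator 1 (x j) - w (x j)) ^ 2 := by
    intro j
    have h1 := hx j
    have h2 := mul_le_mul_of_nonneg_right (hj j) hl.le
    have h3 : 0 ≤ ((j : ℕ) : ℝ) * l := by positivity
    by_cases hM : x j ∈ M
    · rw [Set.indicator_of_mem hM]
      simp only [Pi.one_apply]
      nlinarith
    · rw [Set.indicator_of_notMem hM]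
      nlinarith
  have := (Finset.card_nsmul_le_sum Finset.univ _ _ fun j _ => hge j).trans hsum
  simp only [Finset.card_univ, Fintype.card_fin, nsmul_eq_mul, Nat.cast_add, Nat.cast_one] at this
  linarith

/-- Let `M` be a commensurated subset of an `H`-set and `F` a filter on `H` that behaves like
a neighbourhood filter of `1`. If `|M ∆ hM|` is bounded along `F`, then some set `M'` almost equal
to `M` is fixed by `F`-almost all `h`.

`M'` is a superlevel set of an approximate asymptotic centre of the family `hM` along `F`: a
function `w`, almost equal to the indicator function of `M`, that almost minimises the radius of
a ball about `w` containing the indicator functions of `hM` for `F`-almost all `h`. By the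
parallelogram identity such a `w` is almost fixed along `F`, uniformly on `X`. -/
theorem exists_eventually_smul_eq {M : Set X} (hM : IsCommensurated H M) {F : Filter H}
    (hF1 : pure 1 ≤ F) (hF : Tendsto (fun p : H × H => p.1⁻¹ * p.2) (F ×ˢ F) F) {C : ℝ}
    (hC : ∀ᶠ h in F, ((M ∆ (h • M)).ncard : ℝ) ≤ C) :
    ∃ M' : Set X, (M ∆ M').Finite ∧ ∀ᶠ h in F, h • M' = M' := by
  classical
  set χ : X → ℝ := M.indicator 1 with hχ
  have hχh : ∀ h : H, translateBy h χ =ᶠ[cofinite] χ := fun h => by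
    rw [hχ, translateBy_indicator]
    exact indicator_eventuallyEq_cofinite (by rw [symmDiff_comm]; exact hM h)
  let R : Set ℝ := {r | ∃ w : X → ℝ, χ =ᶠ[cofinite] w ∧
    ∀ᶠ h in F, sqDist (translateBy h χ) w ≤ r}
  have hR0 : ∀ r ∈ R, 0 ≤ r := by
    rintro r ⟨w, -, hr⟩
    exact (sqDist_nonneg _ _).trans (hF1 hr)
  have hRbdd : BddBelow R := ⟨0, hR0⟩
  have hRne : R.Nonempty := by
    refine ⟨C, χ, EventuallyEq.rfl, hC.mono fun h hh => ?_⟩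
    have : ((h • M) ∆ M).Finite := by rw [symmDiff_comm]; exact hM h
    rwa [hχ, translateBy_indicator, sqDist_indicator this, symmDiff_comm]
  set m := sInf R
  obtain ⟨n, hn⟩ := exists_nat_gt (9 * (m + 1))
  set l : ℝ := 1 / (3 * (n + 1)) with hl
  have hlpos : 0 < l := by positivity
  have hl1 : l ≤ 1 := by
    rw [hl, div_le_one (by positivity)]
    have : (0 : ℝ) ≤ n := by positivity
    linarith
  obtain ⟨r, ⟨w, hχw, hr⟩, hrm⟩ := exists_lt_of_csInf_lt hRne
    (show sInf R < m + l ^ 2 / 4 by simp only [m]; linarith [pow_pos hlpos 2])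
  have hgap : 9 * sqDist χ w < n + 1 := by
    have h1 : sqDist (translateBy (1 : H) χ) w ≤ r := hF1 hr
    have h2 : translateBy (1 : H) χ = χ := by ext x; simp [translateBy]
    rw [h2] at h1
    nlinarith
  obtain ⟨a, ha1, ha2, ha⟩ := exists_gap hχw hgap
  -- the near-minimiser `w` is moved by less than the length `l` of the gap
  have hmove : ∀ᶠ g in F, ∀ x, |w x - w (g⁻¹ • x)| < l := by
    filter_upwards [(hF.eventually hr).curry] with g hg x
    have hwg : w =ᶠ[cofinite] translateBy g w :=
      hχw.symm.trans ((hχh g).symm.trans (hχw.translateBy g))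
    have hmem : r - sqDist w (translateBy g w) / 4 ∈ R := by
      refine ⟨fun x => (w x + translateBy g w x) / 2, ?_, ?_⟩
      · filter_upwards [hχw, hχw.trans hwg] with x h1 h2
        rw [← h1, ← h2]
        ring
      · filter_upwards [hr, hg] with h h1 h2
        rw [sqDist_midpoint ((hχh h).trans hχw) ((hχh h).trans (hχw.trans hwg))]
        rw [← sqDist_translateBy g, translateBy_mul, mul_inv_cancel_left] at h2
        linarith
    have h1 : m ≤ _ := csInf_le hRbdd hmem
    have h2 := sq_sub_le_sqDist hwg x
    refine abs_lt_of_sq_lt_sq ?_ hlpos.le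
    simp only [translateBy] at h2
    linarith
  refine ⟨{x | a + l ≤ w x}, ?_, ?_⟩
  · refine (mem_cofinite.1 hχw).subset fun x hx hx' => ?_
    simp only [Set.mem_ofPred_eq] at hx'
    rw [Set.mem_symmDiff, Set.mem_ofPred_eq, ← hx', hχ] at hx
    rcases hx with ⟨h1, h2⟩ | ⟨h1, h2⟩
    · rw [Set.indicator_of_mem h1] at h2
      simp only [Pi.one_apply] at h2
      linarith
    · rw [Set.indicator_of_notMem h2] at h1
      linarith
  · filter_upwards [hmove] with g hg
    ext x
    rw [Set.mem_smul_set_iff_inv_smul_mem]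
    have h1 := abs_lt.1 (hg x)
    simp only [Set.mem_ofPred_eq]
    constructor <;> intro h2
    · rcases ha x with h3 | h3
      · linarith
      · exact h3
    · rcases ha (g⁻¹ • x) with h3 | h3
      · linarith
      · exact h3

end Centre

/-! ### Stabilizers of commensurated sets are open -/

section Stabilizer

variable {H X : Type*} [Group H] [MulAction H X]

theorem ncard_symmDiff_smul_inv (M : Set X) (h : H) :
    (M ∆ (h⁻¹ • M)).ncard = (M ∆ (h • M)).ncard := by
  rw [← Set.ncard_smul_set h (M ∆ (h⁻¹ • M)), Set.smul_set_symmDiff, smul_inv_smul, symmDiff_comm]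

theorem ncard_symmDiff_mul_smul_le {M : Set X} (hM : IsCommensurated H M) (g h : H) :
    (M ∆ ((g * h) • M)).ncard ≤ (M ∆ (g • M)).ncard + (M ∆ (h • M)).ncard := by
  have h1 := (hM h).smul_symmDiff g
  rw [← Set.ncard_smul_set g (M ∆ (h • M)), Set.smul_set_symmDiff, mul_smul]
  exact (Set.ncard_le_ncard (symmDiff_triangle _ (g • M) _) ((hM g).union h1)).trans
    (Set.ncard_union_le _ _)

variable [TopologicalSpace H] [TopologicalSpace X] [DiscreteTopology X] [ContinuousSMul H X]

theorem eventually_smul_eq_of_discrete (h : H) (x : X) : ∀ᶠ g in 𝓝 h, g • x = h • x := by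
  have hc : Continuous fun g : H => g • x := by fun_prop
  exact hc.continuousAt.eventually (p := fun y => y = h • x) (by simp)

variable [IsTopologicalGroup H]

theorem isClosed_ncard_symmDiff_smul_le {M : Set X} (hM : IsCommensurated H M) (n : ℕ) :
    IsClosed {h : H | (M ∆ (h • M)).ncard ≤ n} := by
  rw [← isOpen_compl_iff, isOpen_iff_eventually]
  intro h hh
  have hev : ∀ᶠ g in 𝓝 h, ∀ x ∈ M ∆ (h • M), g⁻¹ • x = h⁻¹ • x :=
    (eventually_all_finite (hM h)).2 fun x _ =>
      (continuous_inv.tendsto h).eventually (eventually_smul_eq_of_discrete h⁻¹ x)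
  filter_upwards [hev] with g hg hle
  refine hh (le_trans (Set.ncard_le_ncard (fun x hx => ?_) (hM g)) hle)
  have h1 := hg x hx
  rw [Set.mem_symmDiff, Set.mem_smul_set_iff_inv_smul_mem] at hx ⊢
  rwa [h1]

/-- By Baire, `h ↦ |M ∆ hM|` is bounded near `1`, so the asymptotic centre applies to the
neighbourhood filter of `1`: the stabilizer of `M` is open. -/
theorem IsCommensurated.eventually_smul_eq [BaireSpace H] {M : Set X} (hM : IsCommensurated H M) :
    ∀ᶠ h in 𝓝 (1 : H), h • M = M := by
  obtain ⟨n, g, hg⟩ := nonempty_interior_of_iUnion_of_closed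
    (fun n : ℕ => isClosed_ncard_symmDiff_smul_le hM n)
    (Set.eq_univ_of_forall fun h => Set.mem_iUnion.2 ⟨(M ∆ (h • M)).ncard,
      (le_rfl : (M ∆ (h • M)).ncard ≤ _)⟩)
  rw [mem_interior_iff_mem_nhds] at hg
  have hC : ∀ᶠ h in 𝓝 (1 : H), ((M ∆ (h • M)).ncard : ℝ) ≤ ((n + n : ℕ) : ℝ) := by
    have hc : Tendsto (fun h : H => g * h) (𝓝 1) (𝓝 g) := by
      simpa using (continuous_const_mul g).tendsto (1 : H)
    filter_upwards [hc.eventually hg] with h (hh : (M ∆ ((g * h) • M)).ncard ≤ n)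
    have h1 := ncard_symmDiff_mul_smul_le hM g⁻¹ (g * h)
    rw [inv_mul_cancel_left, ncard_symmDiff_smul_inv] at h1
    have h2 : g ∈ {h : H | (M ∆ (h • M)).ncard ≤ n} := mem_of_mem_nhds hg
    rw [Set.mem_ofPred_eq] at h2
    exact_mod_cast h1.trans (add_le_add h2 hh)
  have hdiv : Tendsto (fun p : H × H => p.1⁻¹ * p.2) (𝓝 1 ×ˢ 𝓝 1) (𝓝 1) := by
    have hc : Continuous fun p : H × H => p.1⁻¹ * p.2 := by fun_prop
    simpa [nhds_prod_eq] using hc.tendsto (1, 1)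
  obtain ⟨M', hfin, hM'⟩ := exists_eventually_smul_eq hM (pure_le_nhds 1) hdiv hC
  have hD : ∀ᶠ h in 𝓝 (1 : H), ∀ x ∈ M ∆ M', h • x = x :=
    (eventually_all_finite hfin).2 fun x _ => by
      simpa using eventually_smul_eq_of_discrete (1 : H) x
  filter_upwards [hM', hD] with h h1 h3
  have h2 : ∀ x ∈ M ∆ M', h⁻¹ • x = x := fun x hx => inv_smul_eq_iff.2 (h3 x hx).symm
  have h4 : h • (M ∆ M') = M ∆ M' := by
    ext x
    rw [Set.mem_smul_set_iff_inv_smul_mem]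
    refine ⟨fun hx => ?_, fun hx => by rwa [h2 x hx]⟩
    have := h3 _ hx
    rw [smul_inv_smul] at this
    rwa [this]
  have h5 : M = (M ∆ M') ∆ M' := (symmDiff_symmDiff_cancel_right _ _).symm
  rw [h5, Set.smul_set_symmDiff, h4, h1]

end Stabilizer

/-! ### Orthogonal representations from invariant kernels -/

section GNS

variable {H Y E : Type*} [Group H] [MulAction H Y] [NormedAddCommGroup E] [InnerProductSpace ℝ E]

/-- The closed subspace spanned by a family of vectors. -/
noncomputable abbrev closedSpan (ε : Y → E) : Submodule ℝ E :=
  (Submodule.span ℝ (Set.range ε)).topologicalClosure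

theorem mem_closedSpan (ε : Y → E) (y : Y) : ε y ∈ closedSpan ε :=
  Submodule.le_topologicalClosure _ (Submodule.subset_span ⟨y, rfl⟩)

/-- The linear map from formal combinations of elements of `Y` to the closed span of `ε`. -/
noncomputable def toClosedSpan (ε : Y → E) : (Y →₀ ℝ) →ₗ[ℝ] closedSpan ε :=
  Finsupp.linearCombination ℝ fun y => (⟨ε y, mem_closedSpan ε y⟩ : closedSpan ε)

theorem toClosedSpan_single (ε : Y → E) (y : Y) :
    toClosedSpan ε (Finsupp.single y 1) = ⟨ε y, mem_closedSpan ε y⟩ := by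
  simp [toClosedSpan]

theorem coe_toClosedSpan (ε : Y → E) (f : Y →₀ ℝ) :
    (toClosedSpan ε f : E) = Finsupp.linearCombination ℝ ε f := by
  simp [toClosedSpan, Finsupp.linearCombination_apply, Finsupp.sum]

theorem denseRange_toClosedSpan (ε : Y → E) : DenseRange (toClosedSpan ε) := by
  rw [DenseRange, dense_iff_closure_eq, Set.eq_univ_iff_forall]
  rintro ⟨v, hv⟩
  rw [closure_subtype]
  refine closure_mono ?_ hv
  intro w hw
  obtain ⟨c, hc⟩ := Finsupp.mem_span_range_iff_exists_finsupp.1 hw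
  refine ⟨_, ⟨c, rfl⟩, ?_⟩
  rw [coe_toClosedSpan, Finsupp.linearCombination_apply, hc]

theorem norm_toClosedSpan_mapDomain {ε : Y → E}
    (hε : ∀ (h : H) (y z : Y), inner ℝ (ε (h • y)) (ε (h • z)) = inner ℝ (ε y) (ε z)) (h : H)
    (f : Y →₀ ℝ) : ‖toClosedSpan ε (f.mapDomain (h • ·))‖ = ‖toClosedSpan ε f‖ := by
  rw [← sq_eq_sq₀ (norm_nonneg _) (norm_nonneg _), ← Submodule.norm_coe, ← Submodule.norm_coe,
    ← real_inner_self_eq_norm_sq, ← real_inner_self_eq_norm_sq, coe_toClosedSpan, coe_toClosedSpan,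
    Finsupp.linearCombination_mapDomain]
  simp only [Finsupp.linearCombination_apply, Finsupp.sum, sum_inner, inner_sum, inner_smul_left,
    inner_smul_right, Function.comp_apply, hε]

theorem isContinuousRep_of_qPoints_id_eq_top [TopologicalSpace H] [IsTopologicalGroup H]
    {u : H →* (E ≃ₗᵢ[ℝ] E)} (hu : qPoints (MonoidHom.id H) u = ⊤) : IsContinuousRep u := by
  intro v
  have hv : v ∈ qPoints (MonoidHom.id H) u := hu ▸ Submodule.mem_top
  rw [mem_qPoints] at hv
  simp only [MonoidHom.coe_id, comap_id] at hv
  rw [continuous_iff_continuousAt]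
  intro g
  have h1 : Tendsto (fun k => g⁻¹ * k) (𝓝 g) (𝓝 1) := by
    simpa using (continuous_const_mul g⁻¹).tendsto g
  refine (((u g).continuous.tendsto v).comp (hv.comp h1)).congr fun k => ?_
  simp only [Function.comp_apply, ← rep_mul, mul_inv_cancel_left]

variable [CompleteSpace E]

/-- The operator on the closed span of `ε` that extends `ε y ↦ ε (h • y)`. -/
noncomputable def closedSpanMap (ε : Y → E) (h : H) : closedSpan ε →L[ℝ] closedSpan ε :=
  ((toClosedSpan ε).comp (Finsupp.lmapDomain ℝ ℝ (h • ·))).extendOfNorm (toClosedSpan ε)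

theorem closedSpanMap_toClosedSpan {ε : Y → E}
    (hε : ∀ (h : H) (y z : Y), inner ℝ (ε (h • y)) (ε (h • z)) = inner ℝ (ε y) (ε z)) (h : H)
    (f : Y →₀ ℝ) :
    closedSpanMap ε h (toClosedSpan ε f) = toClosedSpan ε (f.mapDomain (h • ·)) :=
  LinearMap.extendOfNorm_eq (denseRange_toClosedSpan ε)
    ⟨1, fun x => by
      rw [one_mul]
      exact (norm_toClosedSpan_mapDomain hε h x).le⟩ f

/-- The orthogonal representation on the closed span of `ε` defined by `ε y ↦ ε (h • y)`, for a
family of vectors with invariant Gram matrix. -/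
noncomputable def closedSpanRep (ε : Y → E)
    (hε : ∀ (h : H) (y z : Y), inner ℝ (ε (h • y)) (ε (h • z)) = inner ℝ (ε y) (ε z)) :
    H →* (closedSpan ε ≃ₗᵢ[ℝ] closedSpan ε) :=
  have hone : ∀ v, closedSpanMap ε (1 : H) v = v := fun v =>
    (denseRange_toClosedSpan ε).induction_on (p := fun v => closedSpanMap ε (1 : H) v = v) v
      (isClosed_eq (by fun_prop) (by fun_prop)) fun f => by
        rw [closedSpanMap_toClosedSpan hε]
        simp only [one_smul]
        exact congrArg _ Finsupp.mapDomain_id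
  have hmul : ∀ (g h : H) (v), closedSpanMap ε (g * h) v =
      closedSpanMap ε g (closedSpanMap ε h v) := fun g h v =>
    (denseRange_toClosedSpan ε).induction_on
      (p := fun v => closedSpanMap ε (g * h) v = closedSpanMap ε g (closedSpanMap ε h v)) v
      (isClosed_eq (by fun_prop) (by fun_prop)) fun f => by
        rw [closedSpanMap_toClosedSpan hε, closedSpanMap_toClosedSpan hε,
          closedSpanMap_toClosedSpan hε, ← Finsupp.mapDomain_comp]
        simp only [mul_smul]
        rfl
  { toFun := fun h =>
      { toLinearEquiv := LinearEquiv.ofLinearMap (closedSpanMap ε h) (closedSpanMap ε h⁻¹)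
          (LinearMap.ext fun v => by simp [← hmul, hone])
          (LinearMap.ext fun v => by simp [← hmul, hone])
        norm_map' := fun v =>
          (denseRange_toClosedSpan ε).induction_on (p := fun v => ‖closedSpanMap ε h v‖ = ‖v‖) v
            (isClosed_eq (by fun_prop) (by fun_prop)) fun f => by
              rw [closedSpanMap_toClosedSpan hε, norm_toClosedSpan_mapDomain hε] }
    map_one' := by
      ext v
      exact congrArg _ (hone v)
    map_mul' := fun g h => by
      ext v
      exact congrArg _ (hmul g h v) }

theorem closedSpanRep_apply (ε : Y → E)
    (hε : ∀ (h : H) (y z : Y), inner ℝ (ε (h • y)) (ε (h • z)) = inner ℝ (ε y) (ε z))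
    (h : H) (y : Y) : closedSpanRep ε hε h ⟨ε y, mem_closedSpan ε y⟩ =
      ⟨ε (h • y), mem_closedSpan ε (h • y)⟩ := by
  rw [← toClosedSpan_single, ← toClosedSpan_single]
  exact (closedSpanMap_toClosedSpan hε h _).trans (by simp)

/-- The vectors that are continuous at `1` form a closed subspace, so it is enough to check the
generators. -/
theorem isContinuousRep_closedSpanRep [TopologicalSpace H] [IsTopologicalGroup H] {ε : Y → E}
    (hε : ∀ (h : H) (y z : Y), inner ℝ (ε (h • y)) (ε (h • z)) = inner ℝ (ε y) (ε z))
    (hcont : ∀ y, ∀ᶠ h in 𝓝 (1 : H), ε (h • y) = ε y) : IsContinuousRep (closedSpanRep ε hε) := by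
  apply isContinuousRep_of_qPoints_id_eq_top
  set W := qPoints (MonoidHom.id H) (closedSpanRep ε hε)
  have hW : ∀ f, toClosedSpan ε f ∈ W := by
    intro f
    rw [toClosedSpan, Finsupp.linearCombination_apply]
    refine Submodule.sum_mem _ fun y _ => Submodule.smul_mem _ _ ?_
    rw [mem_qPoints]
    simp only [MonoidHom.coe_id, comap_id]
    refine tendsto_const_nhds.congr' ?_
    filter_upwards [hcont y] with h hh
    rw [closedSpanRep_apply]
    exact Subtype.ext hh.symm
  refine eq_top_iff.2 fun v _ => ?_
  exact (denseRange_toClosedSpan ε).induction_on (p := fun v => v ∈ W) v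
    (qPoints_isClosed _ _) hW

end GNS

/-! ### The complement of the `Q`-points -/

section Complement

variable {H E : Type*} [Group H] [NormedAddCommGroup E] [InnerProductSpace ℝ E]

/-- The restriction of an orthogonal representation to an invariant subspace. -/
def subRep (u : H →* (E ≃ₗᵢ[ℝ] E)) (W : Submodule ℝ E) (hW : ∀ h, ∀ v ∈ W, u h v ∈ W) :
    H →* (W ≃ₗᵢ[ℝ] W) where
  toFun h :=
    { toLinearEquiv := LinearEquiv.ofLinearMap
        ((u h).toLinearEquiv.toLinearMap.restrict (hW h))
        ((u h⁻¹).toLinearEquiv.toLinearMap.restrict (hW h⁻¹))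
        (LinearMap.ext fun v => Subtype.ext (by simp [LinearMap.restrict_apply]))
        (LinearMap.ext fun v => Subtype.ext (by simp [LinearMap.restrict_apply]))
      norm_map' := fun v => (u h).norm_map v }
  map_one' := by
    ext v
    simp [LinearMap.restrict_apply]
  map_mul' g h := by
    ext v
    simp [LinearMap.restrict_apply]

theorem orthogonal_invariant (u : H →* (E ≃ₗᵢ[ℝ] E)) {W : Submodule ℝ E}
    (hW : ∀ h, ∀ v ∈ W, u h v ∈ W) (h : H) {v : E} (hv : v ∈ Wᗮ) : u h v ∈ Wᗮ := by
  rw [Submodule.mem_orthogonal] at *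
  intro w hw
  have h1 := (u h⁻¹).inner_map_map w (u h v)
  rw [← rep_mul, inv_mul_cancel, map_one] at h1
  rw [← h1]
  exact hv _ (hW h⁻¹ w hw)

end Complement

section Kazhdan

variable {H Q : Type u} [Group H] [TopologicalSpace H] [Group Q] [TopologicalSpace Q]
  [IsTopologicalGroup Q] {E : Type u} [NormedAddCommGroup E] [InnerProductSpace ℝ E]
  [CompleteSpace E]

/-- Almost invariant vectors are close to `Q`-points: the orthogonal complement of the `Q`-points
has no nonzero `Q`-point, so it does not almost have invariant vectors. -/
theorem IsKazhdanHom.exists_norm_sub_le {π : H →* Q} {hd : DenseRange π}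
    (hπ : IsKazhdanHom π hd) {u : H →* (E ≃ₗᵢ[ℝ] E)} (hu : IsContinuousRep u) {δ : ℝ}
    (hδ : 0 < δ) : ∃ K : Set H, IsCompact K ∧ ∃ η > 0, ∀ v : E, (∀ g ∈ K, ‖u g v - v‖ < η) →
      ∃ w ∈ qPoints π u, ‖v - w‖ ≤ δ := by
  set W := qPoints π u
  have : CompleteSpace W := (qPoints_isClosed π u).completeSpace_coe
  have hW : ∀ h, ∀ v ∈ Wᗮ, u h v ∈ Wᗮ := fun h v hv =>
    orthogonal_invariant u (fun h v hv => qPoints_invariant π u hv h) h hv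
  have hu' : IsContinuousRep (subRep u Wᗮ hW) := fun v =>
    continuous_induced_rng.2 (hu v)
  have hnot : ¬ AlmostHasInvariantVectors (subRep u Wᗮ hW) := by
    intro hinv
    obtain ⟨v, hv, -⟩ := hπ Wᗮ _ hu' hinv ∅ isCompact_empty 1 one_pos
    have h1 : (v : E) ≠ 0 := by
      intro h0
      have : v = 0 := Subtype.ext (Subtype.ext h0)
      simp [this] at hv
    have h2 : ((v : Wᗮ) : E) ∈ W := by
      have h3 := (mem_qPoints π _ _).1 v.2
      exact (mem_qPoints π u _).2 ((continuous_subtype_val.tendsto _).comp h3)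
    exact h1 (Submodule.disjoint_def.1 W.orthogonal_disjoint _ h2 v.1.2)
  unfold AlmostHasInvariantVectors at hnot
  push Not at hnot
  obtain ⟨K, hK, ε, hε, hKε⟩ := hnot
  refine ⟨K, hK, ε * δ, by positivity, fun v hv => ?_⟩
  have hP : W.starProjection v ∈ W := W.starProjection_apply_mem v
  refine ⟨W.starProjection v, hP, ?_⟩
  by_contra! hlt
  have hmem : v - W.starProjection v ∈ Wᗮ := W.sub_starProjection_mem_orthogonal v
  set v' : Wᗮ := ⟨v - W.starProjection v, hmem⟩ with hv'
  have hnv : δ < ‖v'‖ := hlt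
  have hpos : 0 < ‖v'‖ := hδ.trans hnv
  obtain ⟨g, hg, hge⟩ := hKε (‖v'‖⁻¹ • v') (by
    rw [norm_smul, norm_inv, norm_norm, inv_mul_cancel₀ hpos.ne'])
  rw [map_smul, ← smul_sub, norm_smul, norm_inv, norm_norm, ← div_eq_inv_mul,
    le_div_iff₀ hpos] at hge
  -- `u g v' - v'` is the component in `Wᗮ` of `u g v - v`
  have hle : ‖subRep u Wᗮ hW g v' - v'‖ ≤ ‖u g v - v‖ := by
    have h1 : u g (W.starProjection v) - W.starProjection v ∈ W :=
      W.sub_mem (qPoints_invariant π u hP g) hP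
    have h2 := W.inner_right_of_mem_orthogonal h1 (subRep u Wᗮ hW g v' - v').2
    have h3 : u g v - v = (u g (W.starProjection v) - W.starProjection v) +
        ((subRep u Wᗮ hW g v' - v' : Wᗮ) : E) := by
      change u g v - v = (u g (W.starProjection v) - W.starProjection v) +
        (u g (v - W.starProjection v) - (v - W.starProjection v))
      rw [map_sub]
      abel
    have h4 := norm_add_sq_eq_norm_sq_add_norm_sq_of_inner_eq_zero _ _ h2
    rw [← h3] at h4
    rw [Submodule.norm_coe] at h4
    nlinarith [norm_nonneg (u g v - v), norm_nonneg (subRep u Wᗮ hW g v' - v'),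
      norm_nonneg (u g (W.starProjection v) - W.starProjection v)]
  have := hv g hg
  nlinarith

end Kazhdan

/-! ### The kernel `c ^ |A ∆ B|` -/

section Kernel

variable {X : Type*}

/-- The vector `⊗_{x ∈ A} (c n, s n) ⊗ ⊗_{x ∉ A} (1, 0)` of the `n`-th copy of the incomplete
tensor product `⊗_{x ∈ X} ℝ²`, written in the orthonormal basis indexed by the finite subsets
of `X`. -/
noncomputable def tensorVec (c s : ℕ → ℝ) (n : ℕ) (A : Finset X) :
    lp (fun _ : ℕ × Finset X => ℝ) 2 :=
  open Classical in
  ∑ S ∈ A.powerset, lp.single 2 (n, S) (s n ^ S.card * c n ^ (A \ S).card)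

theorem inner_tensorVec [DecidableEq X] {c s : ℕ → ℝ} (hcs : ∀ n, s n ^ 2 + c n ^ 2 = 1) (n m : ℕ)
    (A B : Finset X) :
    inner ℝ (tensorVec c s n A) (tensorVec c s m B) = if n = m then c n ^ (A ∆ B).card else 0 := by
  have key : ∀ S ∈ A.powerset, ∀ T ∈ B.powerset,
      inner ℝ (lp.single 2 (n, S) (s n ^ S.card * c n ^ (A \ S).card) :
        lp (fun _ : ℕ × Finset X => ℝ) 2) (lp.single 2 (m, T) (s m ^ T.card * c m ^ (B \ T).card))
      = if S = T then if n = m then (s n ^ S.card * c n ^ (A \ S).card) *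
          (s n ^ S.card * c n ^ (B \ S).card) else 0 else 0 := by
    intro S _ T _
    rw [lp.inner_single_left, lp.single_apply, Pi.single_apply]
    split_ifs <;> simp_all [mul_comm]
  unfold tensorVec
  rw [sum_inner]
  simp_rw [inner_sum]
  rw [Finset.sum_congr rfl fun S hS => Finset.sum_congr rfl fun T hT => by
    convert key S hS T hT]
  by_cases hnm : n = m
  · subst hnm
    simp only [if_true, Finset.sum_ite_eq]
    rw [← Finset.sum_filter]
    have hfil : (A.powerset.filter fun S => S ∈ B.powerset) = (A ∩ B).powerset := by
      ext S
      rw [Finset.mem_filter, Finset.mem_powerset, Finset.mem_powerset, Finset.mem_powerset,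
        Finset.subset_inter_iff]
    rw [hfil]
    have hterm : ∀ S ∈ (A ∩ B).powerset, (s n ^ S.card * c n ^ (A \ S).card) *
        (s n ^ S.card * c n ^ (B \ S).card) =
        c n ^ (A ∆ B).card * ((s n ^ 2) ^ S.card * (c n ^ 2) ^ ((A ∩ B).card - S.card)) := by
      intro S hS
      rw [Finset.mem_powerset] at hS
      have h1 : (A \ S).card = (A \ B).card + ((A ∩ B).card - S.card) := by
        rw [← Finset.card_sdiff_of_subset hS, ← Finset.card_union_of_disjoint]
        · congr 1
          grind
        · rw [Finset.disjoint_left]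
          grind
      have h2 : (B \ S).card = (B \ A).card + ((A ∩ B).card - S.card) := by
        rw [← Finset.card_sdiff_of_subset hS, ← Finset.card_union_of_disjoint]
        · congr 1
          grind
        · rw [Finset.disjoint_left]
          grind
      have h3 : (A ∆ B).card = (A \ B).card + (B \ A).card := by
        rw [← Finset.card_union_of_disjoint]
        · rfl
        · rw [Finset.disjoint_left]
          grind
      rw [h1, h2, h3]
      ring
    rw [Finset.sum_congr rfl hterm, ← Finset.mul_sum, Finset.sum_pow_mul_eq_add_pow, hcs, one_pow,
      mul_one]
  · simp [hnm]

end Kernel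

/-! ### Commensurated sets and Kazhdan homomorphisms -/

section Bound

variable {H : Type u} [Group H]

theorem tendsto_inv_mul_comap {Q : Type*} [Group Q] [TopologicalSpace Q] [IsTopologicalGroup Q]
    (π : H →* Q) : Tendsto (fun p : H × H => p.1⁻¹ * p.2)
      (comap π (𝓝 (1 : Q)) ×ˢ comap π (𝓝 (1 : Q))) (comap π (𝓝 (1 : Q))) := by
  rw [tendsto_comap_iff]
  have h2 : Tendsto (fun p : Q × Q => p.1⁻¹ * p.2) (𝓝 1 ×ˢ 𝓝 1) (𝓝 1) := by
    have hc : Continuous fun p : Q × Q => p.1⁻¹ * p.2 := by fun_prop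
    simpa [nhds_prod_eq] using hc.tendsto (1, 1)
  have h3 := h2.comp ((tendsto_comap (f := π) (x := 𝓝 1)).prodMap
    (tendsto_comap (f := π) (x := 𝓝 1)))
  simpa [Function.comp_def] using h3

theorem pure_one_le_comap {Q : Type*} [Group Q] [TopologicalSpace Q] (π : H →* Q) :
    (pure 1 : Filter H) ≤ comap π (𝓝 (1 : Q)) :=
  map_le_iff_le_comap.1 (by simpa using pure_le_nhds (1 : Q))

variable [TopologicalSpace H] [IsTopologicalGroup H]
  {X : Type u} [TopologicalSpace X] [DiscreteTopology X] [MulAction H X] [ContinuousSMul H X]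

theorem IsCommensurated.exists_forall_ncard_le [BaireSpace H] {M : Set X}
    (hM : IsCommensurated H M) {K : Set H} (hK : IsCompact K) :
    ∃ C : ℕ, ∀ h ∈ K, (M ∆ (h • M)).ncard ≤ C := by
  have hloc : IsLocallyConstant fun h : H => (M ∆ (h • M)).ncard := by
    rw [IsLocallyConstant.iff_eventually_eq]
    intro h
    have h1 : Tendsto (fun k => h⁻¹ * k) (𝓝 h) (𝓝 1) := by
      simpa using (continuous_const_mul h⁻¹).tendsto h
    filter_upwards [h1.eventually hM.eventually_smul_eq] with k hk
    rw [mul_smul, inv_smul_eq_iff] at hk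
    rw [hk]
  obtain ⟨C, hC⟩ := (hK.image hloc.continuous).bddAbove
  exact ⟨C, fun h hh => hC ⟨h, hh, rfl⟩⟩

/-- A commensurated set `M` has an orthogonal representation of `H` with unit vectors `e n` whose
matrix coefficients are `h ↦ c n ^ |M ∆ hM|`. -/
theorem IsCommensurated.exists_rep [BaireSpace H] {M : Set X} (hM : IsCommensurated H M)
    {c : ℕ → ℝ} (hc : ∀ n, c n ^ 2 ≤ 1) :
    ∃ (E : Type u) (_ : NormedAddCommGroup E) (_ : InnerProductSpace ℝ E) (_ : CompleteSpace E)
      (u : H →* (E ≃ₗᵢ[ℝ] E)) (e : ℕ → E), IsContinuousRep u ∧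
      ∀ n h, ‖u h (e n) - e n‖ ^ 2 = 2 - 2 * c n ^ (M ∆ (h • M)).ncard := by
  classical
  -- the Gram matrix lives on pairs `(g, n)`, on which `H` acts through the first component
  let _ : MulAction H (H × ℕ) :=
    { smul := fun h y => (h * y.1, y.2)
      one_smul := fun y => Prod.ext (one_mul _) rfl
      mul_smul := fun g h y => Prod.ext (mul_assoc _ _ _) rfl }
  have hsmul : ∀ (h : H) (y : H × ℕ), h • y = (h * y.1, y.2) := fun _ _ => rfl
  let s : ℕ → ℝ := fun n => √(1 - c n ^ 2)
  have hcs : ∀ n, s n ^ 2 + c n ^ 2 = 1 := fun n => by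
    rw [Real.sq_sqrt (by linarith [hc n])]
    ring
  let ε : H × ℕ → lp (fun _ : ℕ × Finset X => ℝ) 2 :=
    fun y => tensorVec c s y.2 (hM y.1).toFinset
  have hinner : ∀ y z : H × ℕ, inner ℝ (ε y) (ε z) =
      if y.2 = z.2 then c y.2 ^ (M ∆ ((y.1⁻¹ * z.1) • M)).ncard else 0 := by
    intro y z
    have hcard : ((hM y.1).toFinset ∆ (hM z.1).toFinset).card =
        (M ∆ ((y.1⁻¹ * z.1) • M)).ncard := by
      rw [← Set.ncard_coe_finset, Finset.coe_symmDiff, Set.Finite.coe_toFinset,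
        Set.Finite.coe_toFinset, ← Set.ncard_smul_set y.1 (M ∆ _), Set.smul_set_symmDiff,
        ← mul_smul, mul_inv_cancel_left, symmDiff_comm M (y.1 • M), symmDiff_assoc,
        symmDiff_symmDiff_cancel_left]
    rw [inner_tensorVec hcs, hcard]
  have hε : ∀ (h : H) (y z : H × ℕ), inner ℝ (ε (h • y)) (ε (h • z)) = inner ℝ (ε y) (ε z) := by
    intro h y z
    rw [hinner, hinner]
    simp only [hsmul, mul_inv_rev, mul_assoc, inv_mul_cancel_left]
  refine ⟨closedSpan ε, inferInstance, inferInstance, inferInstance, closedSpanRep ε hε,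
    fun n => ⟨ε (1, n), mem_closedSpan ε (1, n)⟩, isContinuousRep_closedSpanRep hε ?_, ?_⟩
  · rintro ⟨g, n⟩
    have hg := (hM.of_finite_symmDiff (hM g)).eventually_smul_eq
    filter_upwards [hg] with h hh
    have : M ∆ ((h * g) • M) = M ∆ (g • M) := by rw [mul_smul, hh]
    simp only [hsmul, ε, this]
  · intro n h
    rw [closedSpanRep_apply, Submodule.coe_norm, Submodule.coe_sub, norm_sub_sq_real,
      ← real_inner_self_eq_norm_sq, ← real_inner_self_eq_norm_sq, real_inner_comm]
    simp only [hinner, hsmul, if_true, mul_one, inv_one, inv_mul_cancel, one_smul, symmDiff_self,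
      Set.bot_eq_empty, Set.ncard_empty, pow_zero, ncard_symmDiff_smul_inv]
    ring

/-- For a Kazhdan homomorphism `π : H → Q`, the function `h ↦ |M ∆ hM|` is bounded on the preimage
of some neighbourhood of `1` in `Q`.

As `c n → 1`, the vectors `e n` of `IsCommensurated.exists_rep` are more and more invariant on any
compact set, so that some `e n` is close to a `Q`-point. -/
theorem IsKazhdanHom.exists_eventually_ncard_le [BaireSpace H] {Q : Type u} [Group Q]
    [TopologicalSpace Q] [IsTopologicalGroup Q] {π : H →* Q} {hd : DenseRange π}
    (hπ : IsKazhdanHom π hd) {M : Set X} (hM : IsCommensurated H M) :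
    ∃ C : ℕ, ∀ᶠ h in comap π (𝓝 (1 : Q)), (M ∆ (h • M)).ncard ≤ C := by
  let c : ℕ → ℝ := fun n => 1 - 1 / ((n : ℝ) + 1)
  have hc0 : ∀ n, 0 ≤ c n := fun n => by
    have h1 : 1 / ((n : ℝ) + 1) ≤ 1 := by
      rw [div_le_one (by positivity)]
      linarith [(Nat.cast_nonneg n : (0 : ℝ) ≤ n)]
    simp only [c]
    linarith
  have hc1 : ∀ n, c n < 1 := fun n => sub_lt_self _ (by positivity)
  have hclim : Tendsto c atTop (𝓝 1) := by
    simpa [c] using (tendsto_one_div_add_atTop_nhds_zero_nat (𝕜 := ℝ)).const_sub 1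
  obtain ⟨E, _, _, _, u, e, hu, he⟩ :=
    hM.exists_rep (c := c) fun n => pow_le_one₀ (hc0 n) (hc1 n).le
  obtain ⟨K, hK, η, hη, hKη⟩ := hπ.exists_norm_sub_le hu (δ := 1 / 8) (by norm_num)
  obtain ⟨C, hC⟩ := hM.exists_forall_ncard_le hK
  have hlim : Tendsto (fun n => 2 - 2 * c n ^ C) atTop (𝓝 0) := by
    simpa using ((hclim.pow C).const_mul 2).const_sub 2
  obtain ⟨n, hn⟩ := (hlim.eventually_lt_const (pow_pos hη 2)).exists
  obtain ⟨w, hw, hew⟩ := hKη (e n) fun g hg => by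
    refine lt_of_pow_lt_pow_left₀ 2 hη.le ?_
    rw [he]
    have := pow_le_pow_of_le_one (hc0 n) (hc1 n).le (hC g hg)
    linarith
  obtain ⟨k, hk⟩ := exists_pow_lt_of_lt_one (show (0 : ℝ) < 7 / 8 by norm_num) (hc1 n)
  refine ⟨k, ?_⟩
  rw [mem_qPoints, Metric.tendsto_nhds] at hw
  filter_upwards [hw (1 / 4) (by norm_num)] with h hh
  by_contra! hlt
  have h1 := pow_le_pow_of_le_one (hc0 n) (hc1 n).le hlt.le
  have h2 : ‖u h (e n) - e n‖ < 1 / 2 := by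
    have h3 := dist_triangle4 (u h (e n)) (u h w) w (e n)
    rw [(u h).dist_map, dist_comm w, dist_eq_norm (e n) w, dist_eq_norm (u h (e n))] at h3
    linarith
  have h3 := he n h
  nlinarith [norm_nonneg (u h (e n) - e n)]

/-- For a Kazhdan homomorphism `π : H → Q`, a commensurated set is almost equal to one that is
invariant under the preimage of some neighbourhood of `1` in `Q`. -/
theorem IsKazhdanHom.exists_eventually_smul_eq [BaireSpace H] {Q : Type u} [Group Q]
    [TopologicalSpace Q] [IsTopologicalGroup Q] {π : H →* Q} {hd : DenseRange π}
    (hπ : IsKazhdanHom π hd) {M : Set X} (hM : IsCommensurated H M) :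
    ∃ M' : Set X, (M ∆ M').Finite ∧ ∀ᶠ h in comap π (𝓝 (1 : Q)), h • M' = M' := by
  obtain ⟨C, hC⟩ := hπ.exists_eventually_ncard_le hM
  exact _root_.exists_eventually_smul_eq hM (pure_one_le_comap π) (tendsto_inv_mul_comap π)
    (hC.mono fun h hh => (Nat.cast_le (α := ℝ)).2 hh)

end Bound

/-! ### The `Q`-set of an `H`-set -/

section QSet

variable {H Q : Type*} [Group H] [Group Q] [TopologicalSpace Q]

/-- In a continuous discrete `Q`-set, the action of `q` on a point is the action of `π h` for some
`h`, with `π h` arbitrarily close to `q`. -/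
theorem DenseRange.exists_smul_eq {π : H →* Q} (hd : DenseRange π) {Z : Type*}
    [TopologicalSpace Z] [DiscreteTopology Z] [MulAction Q Z] [ContinuousSMul Q Z] (q : Q) (z : Z)
    {V : Set Q} (hV : V ∈ 𝓝 q) : ∃ h, π h ∈ V ∧ π h • z = q • z := by
  obtain ⟨_, ⟨h1, h2⟩, h, rfl⟩ :=
    mem_closure_iff_nhds.1 (hd q) _ (inter_mem hV (eventually_smul_eq_of_discrete q z))
  exact ⟨h, h1, h2⟩

variable {X : Type*} [MulAction H X]

/-- The closure in `Q` of the image of the set of all `h : H` that map `x` to `y`. -/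
def closedTransporter (π : H →* Q) (x y : X) : Set Q := closure (π '' {h | h • x = y})

theorem map_mem_closedTransporter (π : H →* Q) {h : H} {x y : X} (hxy : h • x = y) :
    π h ∈ closedTransporter π x y :=
  subset_closure ⟨h, hxy, rfl⟩

theorem one_mem_closedTransporter (π : H →* Q) (x : X) : 1 ∈ closedTransporter π x x := by
  simpa using map_mem_closedTransporter π (one_smul H x)

variable [IsTopologicalGroup Q]

theorem inv_mem_closedTransporter {π : H →* Q} {x y : X} {q : Q}
    (hq : q ∈ closedTransporter π x y) : q⁻¹ ∈ closedTransporter π y x := by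
  refine map_mem_closure continuous_inv hq ?_
  rintro _ ⟨h, rfl, rfl⟩
  exact ⟨h⁻¹, inv_smul_smul h x, map_inv π h⟩

theorem mul_mem_closedTransporter {π : H →* Q} {x y z : X} {q r : Q}
    (hq : q ∈ closedTransporter π y z) (hr : r ∈ closedTransporter π x y) :
    q * r ∈ closedTransporter π x z := by
  refine map_mem_closure₂ continuous_mul hq hr ?_
  rintro _ ⟨h, rfl, rfl⟩ _ ⟨k, rfl, rfl⟩
  exact ⟨h * k, mul_smul h k x, map_mul π h k⟩

end QSet

section QSet

variable {H Q : Type*} [Group H] [Group Q] [TopologicalSpace Q] [IsTopologicalGroup Q]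
  (π : H →* Q) (X : Type*) [MulAction H X]

/-- The equivalence relation on `Q × X` whose quotient is the separated balanced product
`Q ×_H X`: the pairs `(q * π h, x)` and `(q, h • x)` are identified, as well as limits of
such pairs. -/
def balancedSetoid : Setoid (Q × X) where
  r p p' := p'.1⁻¹ * p.1 ∈ closedTransporter π p.2 p'.2
  iseqv :=
    { refl := fun p => by
        rw [inv_mul_cancel]
        exact one_mem_closedTransporter π p.2
      symm := fun {p p'} h => by
        simpa using inv_mem_closedTransporter h
      trans := fun {p p' p''} h h' => by
        simpa [mul_assoc] using mul_mem_closedTransporter h' h }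

/-- The `Q`-set generated by the `H`-set `X`: the separated balanced product `Q ×_H X`, as a
discrete space. -/
def QSet : Type _ := Quotient (balancedSetoid π X)

instance : TopologicalSpace (QSet π X) := ⊥

instance : DiscreteTopology (QSet π X) := ⟨rfl⟩

instance : MulAction Q (QSet π X) where
  smul a := Quotient.map (fun p => (a * p.1, p.2)) fun p p' (h : _ ∈ _) => by
    change (a * p'.1)⁻¹ * (a * p.1) ∈ _
    rwa [mul_inv_rev, mul_assoc, inv_mul_cancel_left]
  one_smul z := by
    induction z using Quotient.inductionOn with
    | h p => exact congrArg (Quotient.mk _) (Prod.ext (one_mul p.1) rfl)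
  mul_smul a b z := by
    induction z using Quotient.inductionOn with
    | h p => exact congrArg (Quotient.mk _) (Prod.ext (mul_assoc a b p.1) rfl)

variable {X}

/-- The canonical map from an `H`-set to the `Q`-set that it generates. -/
def toQSet (x : X) : QSet π X := Quotient.mk (balancedSetoid π X) (1, x)

theorem smul_toQSet_eq_iff (q r : Q) (x y : X) :
    q • toQSet π x = r • toQSet π y ↔ r⁻¹ * q ∈ closedTransporter π x y := by
  have : q • toQSet π x = r • toQSet π y ↔ (r * 1)⁻¹ * (q * 1) ∈ closedTransporter π x y :=
    Quotient.eq (r := balancedSetoid π X)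
  simpa using this

theorem toQSet_eq_iff (x y : X) : toQSet π x = toQSet π y ↔ 1 ∈ closedTransporter π x y := by
  simpa using smul_toQSet_eq_iff π 1 1 x y

theorem toQSet_smul (h : H) (x : X) : toQSet π (h • x) = π h • toQSet π x := by
  rw [eq_comm]
  simpa using (smul_toQSet_eq_iff π (π h) 1 x (h • x)).2
    (by simpa using map_mem_closedTransporter π rfl)

theorem exists_smul_toQSet (z : QSet π X) : ∃ (q : Q) (x : X), q • toQSet π x = z := by
  induction z using Quotient.inductionOn with
  | h p => exact ⟨p.1, p.2, congrArg (Quotient.mk _) (Prod.ext (mul_one _) rfl)⟩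

variable {π}

theorem exists_smul_eq_of_toQSet_eq {x y : X} (hxy : toQSet π x = toQSet π y) {S : Set H}
    (hS : S ∈ comap π (𝓝 (1 : Q))) : ∃ h ∈ S, h • x = y := by
  rw [toQSet_eq_iff] at hxy
  obtain ⟨V, hV, hVS⟩ := hS
  obtain ⟨_, h1, h, h2, rfl⟩ := mem_closure_iff_nhds.1 hxy V hV
  exact ⟨h, hVS h1, h2⟩

variable (π)

/-- The point `x` of an `H`-set has a finite orbit near `1`: the set of all `h • x`, with `π h` in
some neighbourhood of `1` in `Q`, is finite. -/
def IsLocallyFinitePoint (x : X) : Prop := ∃ S ∈ comap π (𝓝 (1 : Q)), ((· • x) '' S).Finite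

variable {π}

/-- The closure of the image of the stabilizer of `x` is open if `x` has a finite orbit near `1`:
near `1`, those closed transporters from `x` that do not contain `1` can be avoided. -/
theorem IsLocallyFinitePoint.closedTransporter_mem_nhds (hd : DenseRange π) {x : X}
    (hx : IsLocallyFinitePoint π x) : closedTransporter π x x ∈ 𝓝 (1 : Q) := by
  obtain ⟨S, hS, hfin⟩ := hx
  have hev : ∀ᶠ q in 𝓝 (1 : Q), ∀ y ∈ (· • x) '' S, 1 ∉ closedTransporter π x y →
      q ∉ closedTransporter π x y :=
    (eventually_all_finite hfin).2 fun y _ => by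
      by_cases h1 : 1 ∈ closedTransporter π x y
      · exact Eventually.of_forall fun q h2 => absurd h1 h2
      · exact (isClosed_closure.isOpen_compl.eventually_mem h1).mono fun q hq _ => hq
  have hH : ∀ᶠ h in comap π (𝓝 (1 : Q)), π h ∈ closedTransporter π x x := by
    filter_upwards [hS, tendsto_comap.eventually hev] with h h1 h2
    have h3 := map_mem_closedTransporter π (rfl : h • x = h • x)
    have h4 : 1 ∈ closedTransporter π x (h • x) := by
      by_contra h5
      exact h2 _ ⟨h, h1, rfl⟩ h5 h3
    simpa using mul_mem_closedTransporter (inv_mem_closedTransporter h4) h3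
  rw [eventually_comap] at hH
  filter_upwards [eventually_eventually_nhds.2 hH] with r hr
  have := neBot_comap hd r
  refine isClosed_closure.mem_of_tendsto (tendsto_comap (f := π) (x := 𝓝 r)) ?_
  filter_upwards [tendsto_comap.eventually hr] with h hh
  exact hh h rfl

theorem continuousSMul_QSet (hd : DenseRange π) (hX : ∀ x : X, IsLocallyFinitePoint π x) :
    ContinuousSMul Q (QSet π X) := by
  refine ⟨continuous_iff_continuousAt.2 ?_⟩
  rintro ⟨q, z⟩
  rw [ContinuousAt, nhds_prod_eq, nhds_discrete (QSet π X), prod_pure, tendsto_map'_iff]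
  refine tendsto_pure.2 ?_
  obtain ⟨r, x, rfl⟩ := exists_smul_toQSet π z
  have hc : Tendsto (fun q' => (q * r)⁻¹ * (q' * r)) (𝓝 q) (𝓝 1) := by
    have : Continuous fun q' => (q * r)⁻¹ * (q' * r) := by fun_prop
    simpa using this.tendsto q
  filter_upwards [hc.eventually ((hX x).closedTransporter_mem_nhds hd)] with q' hq'
  simp only [Function.comp_apply, ← mul_smul]
  exact (smul_toQSet_eq_iff π _ _ _ _).2 hq'

theorem toQSet_surjective (hd : DenseRange π) (hX : ∀ x : X, IsLocallyFinitePoint π x) :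
    Function.Surjective (toQSet π : X → QSet π X) := by
  intro z
  have := continuousSMul_QSet hd hX
  obtain ⟨q, x, rfl⟩ := exists_smul_toQSet π z
  obtain ⟨h, -, hh⟩ := hd.exists_smul_eq q (toQSet π x) univ_mem
  exact ⟨h • x, by rw [toQSet_smul, hh]⟩

theorem isPretransitive_QSet (hd : DenseRange π) (hX : ∀ x : X, IsLocallyFinitePoint π x)
    [MulAction.IsPretransitive H X] : MulAction.IsPretransitive Q (QSet π X) where
  exists_smul_eq z z' := by
    obtain ⟨x, rfl⟩ := toQSet_surjective hd hX z
    obtain ⟨y, rfl⟩ := toQSet_surjective hd hX z'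
    obtain ⟨h, rfl⟩ := MulAction.exists_smul_eq H x y
    exact ⟨π h, (toQSet_smul π h x).symm⟩

theorem smul_image_toQSet (h : H) (M : Set X) :
    π h • (toQSet π '' M) = toQSet π '' (h • M) := by
  simp only [← Set.image_smul, Set.image_image, toQSet_smul]

/-- The image of `M` is invariant under a neighbourhood of `1` in `Q`, so by density every
translate of it by an element of `Q` is also a translate by an element of `H`. -/
theorem isCommensurated_image_toQSet (hd : DenseRange π) (hX : ∀ x : X, IsLocallyFinitePoint π x)
    {M : Set X} (hM : IsCommensurated H M) (hinv : ∀ᶠ h in comap π (𝓝 (1 : Q)), h • M = M) :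
    IsCommensurated Q (toQSet π '' M) := by
  have := continuousSMul_QSet hd hX
  rw [eventually_comap] at hinv
  have hsub : ∀ᶠ q in 𝓝 (1 : Q), q • (toQSet π '' M) ⊆ toQSet π '' M := by
    filter_upwards [eventually_eventually_nhds.2 hinv] with q hq
    rintro _ ⟨_, ⟨x, hx, rfl⟩, rfl⟩
    obtain ⟨h, h1, h2⟩ := hd.exists_smul_eq q (toQSet π x) hq
    refine ⟨h • x, ?_, by simpa [toQSet_smul] using h2⟩
    rw [← h1 h rfl]
    exact Set.smul_mem_smul_set hx
  have heq : ∀ᶠ q in 𝓝 (1 : Q), q • (toQSet π '' M) = toQSet π '' M := by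
    have hi : Tendsto (fun q : Q => q⁻¹) (𝓝 1) (𝓝 1) := by
      simpa using continuous_inv.tendsto (1 : Q)
    filter_upwards [hsub, hi.eventually hsub] with q h1 h2
    exact h1.antisymm (by rwa [Set.subset_smul_set_iff])
  intro q
  have hc : Tendsto (fun r => r⁻¹ * q) (𝓝 q) (𝓝 1) := by
    have : Continuous fun r => r⁻¹ * q := by fun_prop
    simpa using this.tendsto q
  obtain ⟨_, h1, h, rfl⟩ := mem_closure_iff_nhds.1 (hd q) _ (hc.eventually heq)
  have h2 : (π h)⁻¹ • q • (toQSet π '' M) = toQSet π '' M := by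
    rw [← mul_smul]
    exact h1
  rw [inv_smul_eq_iff, smul_image_toQSet] at h2
  rw [h2]
  refine ((hM h).image (toQSet π)).subset ?_
  rintro z (⟨⟨x, hx, rfl⟩, h3⟩ | ⟨⟨x, hx, rfl⟩, h3⟩)
  · exact ⟨x, Or.inl ⟨hx, fun h4 => h3 ⟨x, h4, rfl⟩⟩, rfl⟩
  · exact ⟨x, Or.inr ⟨hx, fun h4 => h3 ⟨x, h4, rfl⟩⟩, rfl⟩

/-- The map `toQSet` has finite fibres, and `M` is a union of fibres. -/
theorem isTransfixed_of_image_toQSet (hd : DenseRange π)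
    (hX : ∀ x : X, IsLocallyFinitePoint π x) {M : Set X}
    (hinv : ∀ᶠ h in comap π (𝓝 (1 : Q)), h • M = M)
    (hM : IsTransfixed Q (toQSet π '' M)) : IsTransfixed H M := by
  obtain ⟨N, hN, hfin⟩ := hM
  have hsat : toQSet π ⁻¹' (toQSet π '' M) = M := by
    refine (Set.subset_preimage_image _ _).antisymm' ?_
    rintro y ⟨x, hx, hxy⟩
    obtain ⟨h, h1, rfl⟩ := exists_smul_eq_of_toQSet_eq hxy hinv
    rw [← show h • M = M from h1]
    exact Set.smul_mem_smul_set hx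
  refine ⟨toQSet π ⁻¹' N, fun g => ?_, ?_⟩
  · ext x
    rw [Set.mem_smul_set_iff_inv_smul_mem, Set.mem_preimage, Set.mem_preimage, toQSet_smul,
      map_inv, ← Set.mem_smul_set_iff_inv_smul_mem, hN]
  · rw [← hsat, ← Set.preimage_symmDiff]
    refine hfin.preimage' fun z _ => ?_
    obtain ⟨x, rfl⟩ := toQSet_surjective hd hX z
    obtain ⟨S, hS, hSfin⟩ := hX x
    refine hSfin.subset fun y (hy : toQSet π y = toQSet π x) => ?_
    exact exists_smul_eq_of_toQSet_eq hy.symm hS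

variable (π X)

/-- The `H`-invariant subset of the points with a finite orbit near `1`. -/
def locallyFinitePoints : SubMulAction H X where
  carrier := {x | IsLocallyFinitePoint π x}
  smul_mem' := by
    rintro g x ⟨S, hS, hfin⟩
    have h1 : Tendsto (fun k => g⁻¹ * k * g) (comap π (𝓝 (1 : Q))) (comap π (𝓝 (1 : Q))) := by
      rw [tendsto_comap_iff]
      have : Tendsto (fun q : Q => (π g)⁻¹ * q * π g) (𝓝 1) (𝓝 1) := by
        have hc : Continuous fun q : Q => (π g)⁻¹ * q * π g := by fun_prop
        simpa using hc.tendsto 1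
      simpa [Function.comp_def] using this.comp tendsto_comap
    refine ⟨_, h1 hS, (hfin.smul_set (a := g)).subset ?_⟩
    rintro _ ⟨k, hk, rfl⟩
    exact ⟨_, ⟨_, hk, rfl⟩, by simp [← mul_smul, mul_assoc]⟩

variable {π X}

theorem isLocallyFinitePoint_subtype (x : locallyFinitePoints π X) :
    IsLocallyFinitePoint π x := by
  obtain ⟨S, hS, hfin⟩ := x.2
  refine ⟨S, hS, Set.Finite.of_finite_image (f := Subtype.val) ?_ Subtype.val_injective.injOn⟩
  rwa [Set.image_image]

/-- Outside the points with a finite orbit near `1`, a commensurated set that is fixed near `1` is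
`H`-invariant: a point of `M ∆ g⁻¹M` has its orbit near `1` in this finite set. -/
theorem smul_mem_iff_of_not_isLocallyFinitePoint {M : Set X} (hM : IsCommensurated H M)
    (hinv : ∀ᶠ h in comap π (𝓝 (1 : Q)), h • M = M) {x : X} (hx : ¬ IsLocallyFinitePoint π x)
    (g : H) : g • x ∈ M ↔ x ∈ M := by
  by_contra hne
  apply hx
  have h1 : Tendsto (fun k => g * k * g⁻¹) (comap π (𝓝 (1 : Q))) (comap π (𝓝 (1 : Q))) := by
    rw [tendsto_comap_iff]
    have : Tendsto (fun q : Q => π g * q * (π g)⁻¹) (𝓝 1) (𝓝 1) := by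
      have hc : Continuous fun q : Q => π g * q * (π g)⁻¹ := by fun_prop
      simpa using hc.tendsto 1
    simpa [Function.comp_def] using this.comp tendsto_comap
  refine ⟨_, inter_mem hinv (h1 hinv), (hM g⁻¹).subset ?_⟩
  rintro _ ⟨k, ⟨hk1, hk2⟩, rfl⟩
  have hk1' : k • M = M := hk1
  have hk2' : k • g⁻¹ • M = g⁻¹ • M := by
    rw [eq_inv_smul_iff, ← mul_smul, ← mul_smul]
    exact hk2
  have h2 : k • (M ∆ (g⁻¹ • M)) = M ∆ (g⁻¹ • M) := by
    rw [Set.smul_set_symmDiff, hk1', hk2']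
  change k • x ∈ _
  rw [← h2]
  refine Set.smul_mem_smul_set ?_
  rw [Set.mem_symmDiff, Set.mem_smul_set_iff_inv_smul_mem, inv_inv]
  tauto

/-- Transfixing a commensurated set that is fixed near `1` reduces to the `Q`-set generated by the
points with a finite orbit near `1`. -/
theorem isTransfixed_of_qSet (hd : DenseRange π) {M : Set X} (hM : IsCommensurated H M)
    (hinv : ∀ᶠ h in comap π (𝓝 (1 : Q)), h • M = M)
    (hQ : ∀ M' : Set (QSet π (locallyFinitePoints π X)), IsCommensurated Q M' →
      IsTransfixed Q M') : IsTransfixed H M := by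
  classical
  have hsm : ∀ (g : H) (A : Set X), g • ((↑) ⁻¹' A : Set (locallyFinitePoints π X)) =
      (↑) ⁻¹' (g • A) := by
    intro g A
    ext x
    simp [Set.mem_smul_set_iff_inv_smul_mem]
  set M₁ : Set (locallyFinitePoints π X) := (↑) ⁻¹' M
  have hM₁ : IsCommensurated H M₁ := fun g => by
    rw [hsm, ← Set.preimage_symmDiff]
    exact (hM g).preimage Subtype.val_injective.injOn
  have hinv₁ : ∀ᶠ h in comap π (𝓝 (1 : Q)), h • M₁ = M₁ := hinv.mono fun h hh => by
    rw [hsm, hh]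
  obtain ⟨N, hN, hfin⟩ := isTransfixed_of_image_toQSet hd isLocallyFinitePoint_subtype hinv₁
    (hQ _ (isCommensurated_image_toQSet hd isLocallyFinitePoint_subtype hM₁ hinv₁))
  -- the transfixing set is `N` on the points with a finite orbit near `1`, and `M` elsewhere
  refine ⟨{x | if hx : x ∈ locallyFinitePoints π X then (⟨x, hx⟩ : locallyFinitePoints π X) ∈ N
    else x ∈ M}, ?_, ?_⟩
  · intro g
    ext x
    rw [Set.mem_smul_set_iff_inv_smul_mem]
    by_cases h : x ∈ locallyFinitePoints π X
    · have h' : g⁻¹ • x ∈ locallyFinitePoints π X := SubMulAction.smul_mem _ _ h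
      simp only [Set.mem_ofPred_eq, h, h', dif_pos]
      have h1 : g⁻¹ • (⟨x, h⟩ : locallyFinitePoints π X) ∈ N ↔
          (⟨x, h⟩ : locallyFinitePoints π X) ∈ N := by
        rw [← Set.mem_smul_set_iff_inv_smul_mem, hN]
      exact h1
    · have h' : g⁻¹ • x ∉ locallyFinitePoints π X := fun h' => h <| by
        simpa using SubMulAction.smul_mem _ g h'
      simp only [Set.mem_ofPred_eq, h, h', dif_neg, not_false_eq_true]
      exact smul_mem_iff_of_not_isLocallyFinitePoint hM hinv h g⁻¹
  · refine (hfin.image Subtype.val).subset fun x hx => ?_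
    by_cases h : x ∈ locallyFinitePoints π X
    · refine ⟨⟨x, h⟩, ?_, rfl⟩
      simpa [Set.mem_symmDiff, h, M₁] using hx
    · simp [Set.mem_symmDiff, h] at hx

end QSet

/-! ### Transfer of Properties FW and FW' -/

section Transfer

/-- A commensurated set of a continuous discrete `Q`-set that is transfixed under a group `H`
acting through a dense homomorphism `H → Q` is transfixed under `Q`. -/
theorem isTransfixed_of_denseRange {H Q : Type*} [Group H] [Group Q] [TopologicalSpace Q]
    {π : H →* Q} (hd : DenseRange π) {X : Type*} [TopologicalSpace X] [DiscreteTopology X]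
    [MulAction Q X] [ContinuousSMul Q X] [MulAction H X] (hπ : ∀ (h : H) (x : X), h • x = π h • x)
    {M : Set X} (hM : IsTransfixed H M) : IsTransfixed Q M := by
  obtain ⟨N, hN, hfin⟩ := hM
  have hsub : ∀ q : Q, q • N ⊆ N := by
    rintro q _ ⟨x, hx, rfl⟩
    obtain ⟨h, -, hh⟩ := hd.exists_smul_eq q x univ_mem
    change q • x ∈ N
    rw [← hh, ← hπ, ← hN h]
    exact Set.smul_mem_smul_set hx
  exact ⟨N, fun q => (hsub q).antisymm (by rw [Set.subset_smul_set_iff]; exact hsub q⁻¹), hfin⟩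

variable {H Q : Type u} [Group H] [TopologicalSpace H] [Group Q] [TopologicalSpace Q]

theorem HasPropertyFW.of_denseRange {π : H →* Q} (hπ : Continuous π) (hd : DenseRange π)
    (hH : HasPropertyFW H) : HasPropertyFW Q := by
  intro X _ _ _ _ M hM
  let _ : MulAction H X := MulAction.compHom X π
  have hsmul : ∀ (h : H) (x : X), h • x = π h • x := fun _ _ => rfl
  have : ContinuousSMul H X := ⟨(hπ.comp continuous_fst).smul continuous_snd⟩
  exact isTransfixed_of_denseRange hd hsmul (hH X M fun h => hM (π h))

theorem HasPropertyFW'.of_denseRange {π : H →* Q} (hπ : Continuous π) (hd : DenseRange π)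
    (hH : HasPropertyFW' H) : HasPropertyFW' Q := by
  intro X _ _ _ _ _ M hM
  let _ : MulAction H X := MulAction.compHom X π
  have hsmul : ∀ (h : H) (x : X), h • x = π h • x := fun _ _ => rfl
  have : ContinuousSMul H X := ⟨(hπ.comp continuous_fst).smul continuous_snd⟩
  have : MulAction.IsPretransitive H X := ⟨fun x y => by
    obtain ⟨q, rfl⟩ := MulAction.exists_smul_eq Q x y
    obtain ⟨h, -, hh⟩ := hd.exists_smul_eq q x univ_mem
    exact ⟨h, hh⟩⟩
  exact isTransfixed_of_denseRange hd hsmul (hH X M fun h => hM (π h))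

variable [IsTopologicalGroup H] [IsTopologicalGroup Q] [BaireSpace H]

/-- A commensurated set `M` of an `H`-set is transfixed if the commensurated sets of one
`Q`-set are. -/
theorem IsKazhdanHom.isTransfixed {π : H →* Q} {hd : DenseRange π} (hπ : IsKazhdanHom π hd)
    {X : Type u} [TopologicalSpace X] [DiscreteTopology X] [MulAction H X] [ContinuousSMul H X]
    (hQ : ∀ M' : Set (QSet π (locallyFinitePoints π X)), IsCommensurated Q M' →
      IsTransfixed Q M') {M : Set X} (hM : IsCommensurated H M) : IsTransfixed H M := by
  obtain ⟨M', hfin, hinv⟩ := hπ.exists_eventually_smul_eq hM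
  exact (isTransfixed_of_qSet hd (hM.of_finite_symmDiff hfin) hinv hQ).of_finite_symmDiff hfin

theorem IsKazhdanHom.hasPropertyFW {π : H →* Q} {hd : DenseRange π} (hπ : IsKazhdanHom π hd)
    (hQ : HasPropertyFW Q) : HasPropertyFW H := by
  intro X _ _ _ _ M hM
  have := continuousSMul_QSet hd (isLocallyFinitePoint_subtype (π := π) (X := X))
  exact hπ.isTransfixed (hQ _) hM

theorem IsKazhdanHom.hasPropertyFW' {π : H →* Q} {hd : DenseRange π} (hπ : IsKazhdanHom π hd)
    (hQ : HasPropertyFW' Q) : HasPropertyFW' H := by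
  intro X _ _ _ _ _ M hM
  have := continuousSMul_QSet hd (isLocallyFinitePoint_subtype (π := π) (X := X))
  have : MulAction.IsPretransitive H (locallyFinitePoints π X) := ⟨fun x y => by
    obtain ⟨h, hh⟩ := MulAction.exists_smul_eq H (x : X) (y : X)
    exact ⟨h, Subtype.ext hh⟩⟩
  have := isPretransitive_QSet hd (isLocallyFinitePoint_subtype (π := π) (X := X))
  exact hπ.isTransfixed (hQ _) hM

end Transfer

theorem mainTheorem4 {H Q : Type u}
    [Group H] [TopologicalSpace H] [IsTopologicalGroup H] [LocallyCompactSpace H]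
    [Group Q] [TopologicalSpace Q] [IsTopologicalGroup Q] [LocallyCompactSpace Q]
    (π : H →* Q) (hcont : Continuous π) (hdense : DenseRange π)
    (hKazhdan : IsKazhdanHom π hdense) :
    (HasPropertyFW H ↔ HasPropertyFW Q) ∧ (HasPropertyFW' H ↔ HasPropertyFW' Q) :=
  ⟨⟨fun h => h.of_denseRange hcont hdense, hKazhdan.hasPropertyFW⟩,
    ⟨fun h => h.of_denseRange hcont hdense, hKazhdan.hasPropertyFW'⟩⟩
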